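/- **Theorem (Convergence to the real direction $x$).** A linear array has $M\ge 2$ antennas with spacing $d>0$ at wavelength $\lambda>0$, and steering vector $\mathbf a(v)=\big[1,e^{j\frac{2\pi d}{\lambda}v},\dots,e^{j\frac{2\pi d}{\lambda}(M-1)v}\big]^{\mathsf H}$. Let $x\in[-1,1]$ be the (static) sine of the angle of arrival. The estimates $\hat x_n$ of $x$ are computed recursively from an initial estimate $\hat x_0$: for $n=1,2,\dots$, $$\mathbf w_n=\tfrac1{\sqrt M}\,\mathbf a(\hat x_{n-1}),\qquad y_n=\mathbf w_n^{\mathsf H}\mathbf a(x)+\frac{z_n}{\sqrt\rho},\qquad \hat x_n=\max\big\{\min\{\hat x_{n-1}-a_n\operatorname{Im}\{y_n\},\,1\},\,-1\big\},$$ where $\rho>0$ is the signal-to-noise ratio, the $z_n$ are i.i.d. circularly symmetric complex Gaussian random variables with zero mean and unit variance, $\hat x_0$ is a random variable independent of $(z_n)_{n\ge1}$ (possibly deterministic), and the step-sizes are $a_n=\frac{\alpha}{n+N_0}$. Let $\mathcal B(x)=\left(x-\frac{\lambda}{Md},\,x+\frac{\lambda}{Md}\right)\cap[-1,1]$ be the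 mainlobe. Then there is a function $C$, positive on $\mathcal B(x)$ and depending only on $M,d,\lambda,x$, such that for every $\alpha>0$ there is an integer $N_0\ge 0$ (not depending on $\rho$ or $\hat x_0$) such that for every $\rho>0$, almost surely on the event $\{\hat x_0\in\mathcal B(x)\}$, $$P\big(\hat x_n\to x\,\big|\,\hat x_0\big)\;\ge\;1-2\,e^{-C(\hat x_0)\,\rho/\alpha^2}.$$ In particular, for a deterministic $\hat x_0\in\mathcal B(x)$, $P(\hat x_n\to x)\ge 1-2e^{-C(\hat x_0)\rho/\alpha^2}$. -/

import Mathlib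

open MeasureTheory ProbabilityTheory Filter Topology

namespace BeamTracking

noncomputable section

/-- The circularly symmetric complex Gaussian law with zero mean and unit variance:
real and imaginary parts are independent real Gaussians of mean `0` and variance `1/2`. -/
def stdComplexGaussian : Measure ℂ :=
  ((gaussianReal 0 (1 / 2)).prod (gaussianReal 0 (1 / 2))).map
    (fun p : ℝ × ℝ => (⟨p.1, p.2⟩ : ℂ))

/-- The steering vector `a(v) = [1, e^{j(2πd/λ)v}, …, e^{j(2πd/λ)(M-1)v}]ᴴ` of a linear array of
`M` antennas with spacing `d` at wavelength `lam`. -/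
def steeringVector (M : ℕ) (d lam v : ℝ) : Fin M → ℂ :=
  star fun m => Complex.exp (Complex.I * ((2 * Real.pi * d / lam * (m : ℕ) * v : ℝ) : ℂ))

/-- The beamforming vector `w = a(v) / √M` that points the array in direction `v`. -/
def beamformer (M : ℕ) (d lam v : ℝ) : Fin M → ℂ :=
  ((1 / Real.sqrt M : ℝ) : ℂ) • steeringVector M d lam v

/-- The observation `y = wᴴ a(x) + ζ / √ρ`, for the true direction `x`, the beamforming
vector `w`, the signal-to-noise ratio `ρ` and the noise value `ζ`. -/
def observation (M : ℕ) (d lam ρ x : ℝ) (w : Fin M → ℂ) (ζ : ℂ) : ℂ :=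
  star w ⬝ᵥ steeringVector M d lam x + ζ / ((Real.sqrt ρ : ℝ) : ℂ)

/-- The diminishing step-size `a_n = α / (n + N₀)`, used for `n ≥ 1`. -/
def stepSize (α : ℝ) (N₀ n : ℕ) : ℝ := α / ((n : ℝ) + N₀)

/-- The recursive beam tracker for a static direction `x`: started at `x₀`, it probes in
time-slot `n + 1` with the beamforming vector steered to the current estimate, and updates the
estimate by `x̂_{n+1} = [x̂_n - a_{n+1} Im y_{n+1}]_{-1}^{1}`, where `[u]_b^c = max (min u c) b`.
The noise in time-slot `n + 1` is `ζ n`. -/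
def estimate (M : ℕ) (d lam ρ x α : ℝ) (N₀ : ℕ) (x₀ : ℝ) (ζ : ℕ → ℂ) : ℕ → ℝ
  | 0 => x₀
  | n + 1 =>
    let v := estimate M d lam ρ x α N₀ x₀ ζ n
    let y := observation M d lam ρ x (beamformer M d lam v) (ζ n)
    max (min (v - stepSize α N₀ (n + 1) * y.im) 1) (-1)

/-- The mainlobe `B(x) = (x - λ/(Md), x + λ/(Md)) ∩ [-1, 1]`. -/
def mainlobe (M : ℕ) (d lam x : ℝ) : Set ℝ :=
  Set.Ioo (x - lam / (M * d)) (x + lam / (M * d)) ∩ Set.Icc (-1) 1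

end

end BeamTracking

/-! The imaginary part of the observation is `drift` plus Gaussian noise. The drift is odd about `x`
and, by the closed form of the array factor, points away from `x` throughout the mainlobe;
subtracting it therefore pulls the estimate towards `x`. A large `N₀` keeps every step from
overshooting `x`.

The accumulated weighted noise is a Gaussian walk of total variance at most `α ^ 2 / (2 * ρ)`. It
converges almost surely (`ae_cauchySeq_sum`), and by Doob's inequality for its exponentials
(`measure_exists_lt_abs_sum_le`) it exceeds a level `δ` with probability at most `2 exp (-δ ^ 2 ρ /
α ^ 2)`.

The rest is pathwise. With `δ` a third of the distance from the start to the mainlobe edge, the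
estimate stays in a compact part of the lobe (`abs_clamped_sub_le`). There the divergent sum of step
sizes forces convergence (`tendsto_clamped`). Independence allows the random start to be frozen. -/

namespace BeamTracking

/-! ### Deterministic analysis of clamped recursions -/

section Clamped

variable {v a S : ℕ → ℝ} {f : ℝ → ℝ} {x R : ℝ}

/-- One step of a clamped recursion without overshoot moves the noise-compensated error by no more
than the accumulated noise. -/
lemma abs_clamp_step_le {u s T T' K : ℝ} (hx : x ∈ Set.Icc (-1 : ℝ) 1)
    (hup : x ≤ u → 0 ≤ s ∧ s ≤ u - x) (hdown : u ≤ x → s ≤ 0 ∧ u - x ≤ s)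
    (hT : |T| ≤ K) (hT' : |T'| ≤ K) (hu : |u - x + T| ≤ K) :
    |max (min (u - s - (T' - T)) 1) (-1) - x + T'| ≤ K := by
  obtain ⟨hx1, hx2⟩ := hx
  rw [abs_le] at *
  -- The compensated error is `u - x + T - s`, which lies between `T` and `u - x + T`.
  have hw : -K ≤ u - s - (T' - T) - x + T' ∧ u - s - (T' - T) - x + T' ≤ K := by
    rcases le_total x u with h | h
    · obtain ⟨h1, h2⟩ := hup h
      constructor <;> linarith
    · obtain ⟨h1, h2⟩ := hdown h
      constructor <;> linarith
  -- An active clamp lands between `x` and the unclamped point, so the error lies between `T'` and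
  -- the one just bounded.
  rcases le_total (u - s - (T' - T)) 1 with h1 | h1
  · rw [min_eq_left h1]
    rcases le_total (u - s - (T' - T)) (-1) with h2 | h2
    · rw [max_eq_right h2]; constructor <;> linarith
    · rw [max_eq_left h2]; exact hw
  · rw [min_eq_right h1, max_eq_left (by norm_num)]; constructor <;> linarith

/-- Accumulated noise at most `η` after time `N` displaces a clamped recursion by at most
`max r η + η` from its target. -/
lemma abs_clamped_sub_le (hx : x ∈ Set.Icc (-1 : ℝ) 1)
    (hv : ∀ n, v (n + 1) = max (min (v n - a n * f (v n) - (S (n + 1) - S n)) 1) (-1))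
    (hup : ∀ n u, x ≤ u → u < x + R → 0 ≤ a n * f u ∧ a n * f u ≤ u - x)
    (hdown : ∀ n u, u ≤ x → x - R < u → a n * f u ≤ 0 ∧ u - x ≤ a n * f u)
    {N : ℕ} {r η : ℝ} (hS : ∀ n, N ≤ n → |S n - S N| ≤ η) (hr : |v N - x| ≤ r)
    (hR : max r η + η < R) {n : ℕ} (hn : N ≤ n) : |v n - x| ≤ max r η + η := by
  have key : ∀ n, N ≤ n → |v n - x + (S n - S N)| ≤ max r η → |v n - x| ≤ max r η + η := by
    intro n hn h
    have := abs_sub (v n - x + (S n - S N)) (S n - S N)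
    rw [add_sub_cancel_right] at this
    linarith [hS n hn]
  refine key n hn ?_
  -- The invariant is the compensated error; the bound on `|v n - x|` alone is not inductive.
  induction n, hn using Nat.le_induction with
  | base => simpa using Or.inl hr
  | succ n hn ih =>
    have hlt : |v n - x| < R := (key n hn ih).trans_lt hR
    rw [abs_lt] at hlt
    have := abs_clamp_step_le hx (u := v n) (s := a n * f (v n)) (T := S n - S N)
      (T' := S (n + 1) - S N) (K := max r η) (fun h => hup n _ h (by linarith))
      (fun h => hdown n _ h (by linarith)) ((hS n hn).trans (le_max_right _ _))
      ((hS _ (by lia)).trans (le_max_right _ _)) ih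
    rw [hv n]
    rwa [sub_sub_sub_cancel_right] at this

/-- A sequence cannot stay nonnegative under a drift of divergent total strength and bounded
accumulated noise. -/
lemma false_of_drift {w T : ℕ → ℝ} {c B : ℝ} {N : ℕ} (hc : 0 < c)
    (ha : Tendsto (fun n => ∑ i ∈ Finset.range n, a i) atTop atTop)
    (hT : ∀ n, N ≤ n → |T n - T N| ≤ B) (hw : ∀ n, N ≤ n → 0 ≤ w n)
    (hstep : ∀ n, N ≤ n → w (n + 1) ≤ w n - a n * c - (T (n + 1) - T n)) : False := by
  have hsum : ∀ n, N ≤ n → w n ≤ w N -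
      c * (∑ i ∈ Finset.range n, a i - ∑ i ∈ Finset.range N, a i) - (T n - T N) := by
    intro n hn
    induction n, hn using Nat.le_induction with
    | base => simp
    | succ n hn ih =>
      rw [Finset.sum_range_succ]
      have := hstep n hn
      linarith
  obtain ⟨n, h1, h2⟩ := ((ha.eventually_gt_atTop
    ((w N + B) / c + ∑ i ∈ Finset.range N, a i)).and (eventually_ge_atTop N)).exists
  have h3 := hsum n h2
  have h4 := (abs_le.1 (hT n h2)).1
  have h5 : (w N + B) / c < ∑ i ∈ Finset.range n, a i - ∑ i ∈ Finset.range N, a i := by linarith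
  rw [div_lt_iff₀ hc] at h5
  linarith [hw n h2]

/-- A clamped recursion that stays in a compact part of the attraction region of its target
converges to the target when the accumulated noise converges. -/
lemma tendsto_clamped (hx : x ∈ Set.Icc (-1 : ℝ) 1)
    (hv : ∀ n, v (n + 1) = max (min (v n - a n * f (v n) - (S (n + 1) - S n)) 1) (-1))
    (hup : ∀ n u, x ≤ u → u < x + R → 0 ≤ a n * f u ∧ a n * f u ≤ u - x)
    (hdown : ∀ n u, u ≤ x → x - R < u → a n * f u ≤ 0 ∧ u - x ≤ a n * f u)
    (hf : Continuous f) (hpos : ∀ u, x < u → u < x + R → 0 < f u)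
    (hneg : ∀ u, u < x → x - R < u → f u < 0)
    (ha0 : ∀ n, 0 ≤ a n) (ha : Tendsto (fun n => ∑ i ∈ Finset.range n, a i) atTop atTop)
    (hS : CauchySeq S) {r : ℝ} (hr : r < R) (hvr : ∀ n, |v n - x| ≤ r) :
    Tendsto v atTop (𝓝 x) := by
  obtain ⟨hx1, hx2⟩ := hx
  have hr0 : 0 ≤ r := (abs_nonneg _).trans (hvr 0)
  have hRpos : 0 < R := hr0.trans_lt hr
  -- Recurrence: otherwise, once noise increments are at most `ε`, the sequence cannot jump across
  -- the `ε`-neighbourhood of `x`. It stays on one side, where by compactness the drift is bounded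
  -- away from zero.
  have hrec : ∀ ε > 0, ∀ N, ∃ n, N ≤ n ∧ |v n - x| ≤ ε := by
    intro ε hε N₁
    by_contra! hcon
    obtain ⟨N₂, hN₂⟩ := Metric.cauchySeq_iff.1 hS ε hε
    set N := max N₁ N₂ with hN
    have hnoise : ∀ n m, N ≤ n → N ≤ m → |S n - S m| ≤ ε := fun n m hn hm =>
      (hN₂ n (le_of_max_le_right hn) m (le_of_max_le_right hm)).le
    have hfar : ∀ n, N ≤ n → ε < |v n - x| := fun n hn => hcon n (le_of_max_le_left hn)
    have hεr : ε ≤ r := (hfar N le_rfl).le.trans (hvr N)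
    have hbound := fun n => abs_le.1 (hvr n)
    rcases lt_abs.1 (hfar N le_rfl) with h0 | h0
    · have hside : ∀ n, N ≤ n → ε < v n - x := by
        intro n hn
        induction n, hn using Nat.le_induction with
        | base => exact h0
        | succ n hn ih =>
          have h1 := (hup n (v n) (by linarith) (by linarith [hbound n])).2
          have h2 := abs_le.1 (hnoise (n + 1) n (by lia) hn)
          have h3 : x - ε ≤ v (n + 1) := by
            rw [hv n]
            exact le_max_of_le_left (le_min (by linarith) (by linarith))
          rcases lt_abs.1 (hfar (n + 1) (by lia)) with h | h <;> linarith
      obtain ⟨u, hu, hmin⟩ := isCompact_Icc.exists_isMinOn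
        (Set.nonempty_Icc.2 (by linarith : x + ε ≤ x + r)) hf.continuousOn
      refine false_of_drift (a := a) (w := fun n => v n - x) (T := S)
        (hpos u (by linarith [hu.1]) (by linarith [hu.2])) ha
        (fun n hn => hnoise n N hn le_rfl) (fun n hn => by linarith [hside n hn]) ?_
      intro n hn
      have h1 : f u ≤ f (v n) := hmin ⟨by linarith [hside n hn], by linarith [hbound n]⟩
      have h2 := mul_le_mul_of_nonneg_left h1 (ha0 n)
      -- The upper clamp only lowers the value; the lower one is inactive because `v (n + 1) > x ≥
      -- -1`.
      have h3 : v (n + 1) ≤ v n - a n * f (v n) - (S (n + 1) - S n) := by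
        have h4 := hside (n + 1) (by lia)
        rw [hv n] at h4 ⊢
        refine max_le (min_le_left _ _) ?_
        by_contra! h5
        rw [max_eq_right ((min_le_left _ _).trans h5.le)] at h4
        linarith
      linarith
    · have hside : ∀ n, N ≤ n → ε < x - v n := by
        intro n hn
        induction n, hn using Nat.le_induction with
        | base => linarith
        | succ n hn ih =>
          have h1 := (hdown n (v n) (by linarith) (by linarith [hbound n])).2
          have h2 := abs_le.1 (hnoise (n + 1) n (by lia) hn)
          have h3 : v (n + 1) ≤ x + ε := by
            rw [hv n]
            exact max_le ((min_le_left _ _).trans (by linarith)) (by linarith)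
          rcases lt_abs.1 (hfar (n + 1) (by lia)) with h | h <;> linarith
      obtain ⟨u, hu, hmax⟩ := isCompact_Icc.exists_isMaxOn
        (Set.nonempty_Icc.2 (by linarith : x - r ≤ x - ε)) hf.continuousOn
      refine false_of_drift (a := a) (w := fun n => x - v n) (T := fun n => - S n) (B := ε)
        (neg_pos.2 (hneg u (by linarith [hu.2]) (by linarith [hu.1]))) ha
        (fun n hn => ?_) (fun n hn => by linarith [hside n hn]) ?_
      · rw [neg_sub_neg]
        exact hnoise N n le_rfl hn
      intro n hn
      have h1 : f (v n) ≤ f u := hmax ⟨by linarith [hbound n], by linarith [hside n hn]⟩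
      have h2 := mul_le_mul_of_nonneg_left h1 (ha0 n)
      have h3 : v n - a n * f (v n) - (S (n + 1) - S n) ≤ v (n + 1) := by
        have h4 := hside (n + 1) (by lia)
        rw [hv n] at h4 ⊢
        refine le_max_of_le_left (le_min le_rfl ?_)
        by_contra! h5
        rw [min_eq_right h5.le, max_eq_left (by norm_num)] at h4
        linarith
      linarith
  rw [Metric.tendsto_atTop]
  intro ε hε
  -- Restarting within `η` of `x` with tail noise at most `η` gives displacement `2 * η`, below both
  -- `ε` and `R`.
  set η := min (ε / 4) (R / 4) with hη
  have hη0 : 0 < η := by positivity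
  have hη1 : η ≤ ε / 4 := min_le_left _ _
  have hη2 : η ≤ R / 4 := min_le_right _ _
  obtain ⟨N₁, hN₁⟩ := Metric.cauchySeq_iff.1 hS η hη0
  obtain ⟨N, hN, hvN⟩ := hrec η hη0 N₁
  refine ⟨N, fun n hn => ?_⟩
  have := abs_clamped_sub_le ⟨hx1, hx2⟩ hv hup hdown (η := η)
    (fun n hn => (hN₁ n (hN.trans hn) N hN).le) hvN (by rw [max_self]; linarith) hn
  rw [max_self] at this
  rw [Real.dist_eq]
  linarith

end Clamped

/-! ### Maximal inequality and convergence for Gaussian random walks -/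

section GaussianSums

variable {Ω : Type*} {mΩ : MeasurableSpace Ω} {μ : Measure Ω}
  {ξ : ℕ → Ω → ℝ} {s : ℕ → NNReal}

lemma integrable_exp_mul_of_map_eq_gaussianReal {X : Ω → ℝ} {v : NNReal} (hX : Measurable X)
    (h : μ.map X = gaussianReal 0 v) (t : ℝ) : Integrable (fun ω => Real.exp (t * X ω)) μ := by
  have := integrable_exp_mul_gaussianReal (μ := 0) (v := v) t
  rw [← h] at this
  exact this.comp_measurable hX

lemma mgf_sum_of_map_eq_gaussianReal (hm : ∀ n, Measurable (ξ n)) (hi : iIndepFun ξ μ)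
    (hξ : ∀ n, μ.map (ξ n) = gaussianReal 0 (s n)) (t : ℝ) (n : ℕ) :
    mgf (∑ i ∈ Finset.range n, ξ i) μ t =
      Real.exp (t ^ 2 * (∑ i ∈ Finset.range n, (s i : ℝ)) / 2) := by
  rw [hi.mgf_sum hm, Finset.prod_congr rfl fun i _ => mgf_gaussianReal (hξ i) t,
    ← Real.exp_sum, Finset.mul_sum, Finset.sum_div]
  congr 1
  exact Finset.sum_congr rfl fun i _ => by ring

variable [IsProbabilityMeasure μ]

/-- The exponential of a random walk with independent centered Gaussian steps is a
submartingale. -/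
lemma submartingale_exp_sum (hm : ∀ n, Measurable (ξ n)) (hi : iIndepFun ξ μ)
    (hξ : ∀ n, μ.map (ξ n) = gaussianReal 0 (s n)) (t : ℝ) :
    Submartingale (fun n ω => Real.exp (t * ∑ i ∈ Finset.range (n + 1), ξ i ω))
      (Filtration.natural ξ fun n => (hm n).stronglyMeasurable) μ := by
  set ℱ := Filtration.natural ξ fun n => (hm n).stronglyMeasurable
  have hadp : StronglyAdapted ℱ
      (fun n ω => Real.exp (t * ∑ i ∈ Finset.range (n + 1), ξ i ω)) := by
    intro n
    refine Real.continuous_exp.comp_stronglyMeasurable (StronglyMeasurable.const_mul ?_ t)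
    refine Finset.stronglyMeasurable_fun_sum _ fun i hin => ?_
    exact (Filtration.stronglyAdapted_natural (fun n => (hm n).stronglyMeasurable) i).mono
      (ℱ.mono (Finset.mem_range_succ_iff.1 hin))
  have hint : ∀ n, Integrable
      (fun ω => Real.exp (t * ∑ i ∈ Finset.range (n + 1), ξ i ω)) μ := by
    intro n
    simpa [Finset.sum_apply] using hi.integrable_exp_mul_sum (t := t) hm
      (s := Finset.range (n + 1))
      (fun i _ => integrable_exp_mul_of_map_eq_gaussianReal (hm i) (hξ i) t)
  refine submartingale_nat hadp hint fun n => ?_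
  have hstep := integrable_exp_mul_of_map_eq_gaussianReal (hm (n + 1)) (hξ (n + 1)) t
  have hsplit : (fun ω => Real.exp (t * ∑ i ∈ Finset.range (n + 1 + 1), ξ i ω)) =
      (fun ω => Real.exp (t * ∑ i ∈ Finset.range (n + 1), ξ i ω)) *
        fun ω => Real.exp (t * ξ (n + 1) ω) := by
    ext ω
    rw [Pi.mul_apply, ← Real.exp_add, Finset.sum_range_succ _ (n + 1), mul_add]
  have hpull := condExp_mul_of_stronglyMeasurable_left (hadp n) (hsplit ▸ hint (n + 1)) hstep
  have hmean := condExp_indep_eq (μ := μ) (f := fun ω => Real.exp (t * ξ (n + 1) ω))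
    (hm (n + 1)).comap_le (ℱ.le n)
    (Real.continuous_exp.comp_stronglyMeasurable
      ((comap_measurable (ξ (n + 1))).stronglyMeasurable.const_mul t))
    (hi.indep_comap_natural_of_lt (fun n => (hm n).stronglyMeasurable) n.lt_succ_self)
  have hone : 1 ≤ ∫ ω, Real.exp (t * ξ (n + 1) ω) ∂μ := by
    change 1 ≤ mgf (ξ (n + 1)) μ t
    rw [mgf_gaussianReal (hξ (n + 1)), Real.one_le_exp_iff, zero_mul, zero_add]
    positivity
  rw [hsplit]
  filter_upwards [hpull, hmean] with ω h1 h2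
  rw [h1, Pi.mul_apply, h2]
  exact le_mul_of_one_le_right (Real.exp_pos _).le hone

/-- The exponential maximal inequality for Gaussian random walks. -/
lemma measure_exists_le_mul_sum_le (hm : ∀ n, Measurable (ξ n)) (hi : iIndepFun ξ μ)
    (hξ : ∀ n, μ.map (ξ n) = gaussianReal 0 (s n)) {V : ℝ}
    (hV : ∀ n, ∑ i ∈ Finset.range n, (s i : ℝ) ≤ V) (t c : ℝ) :
    μ {ω | ∃ n, c ≤ t * ∑ i ∈ Finset.range (n + 1), ξ i ω} ≤
      ENNReal.ofReal (Real.exp (t ^ 2 * V / 2 - c)) := by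
  have hsub := submartingale_exp_sum hm hi hξ t
  set f : ℕ → Ω → ℝ := fun n ω => Real.exp (t * ∑ i ∈ Finset.range (n + 1), ξ i ω) with hf
  have hmean : ∀ n, ∫ ω, f n ω ∂μ ≤ Real.exp (t ^ 2 * V / 2) := by
    intro n
    have := mgf_sum_of_map_eq_gaussianReal hm hi hξ t (n + 1)
    simp only [mgf, Finset.sum_apply] at this
    rw [hf, this, Real.exp_le_exp]
    have := mul_le_mul_of_nonneg_left (hV (n + 1)) (sq_nonneg t)
    linarith
  set ε : NNReal := ⟨Real.exp c, (Real.exp_pos c).le⟩ with hε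
  -- Doob's inequality bounds each finite horizon uniformly; the events increase, so the bound
  -- passes to their union.
  set A : ℕ → Set Ω := fun n =>
    {ω | (ε : ℝ) ≤ (Finset.range (n + 1)).sup' Finset.nonempty_range_add_one fun k => f k ω}
  have hA : ∀ n, μ (A n) ≤ ENNReal.ofReal (Real.exp (t ^ 2 * V / 2 - c)) := by
    intro n
    have h1 := maximal_ineq hsub (fun n ω => (Real.exp_pos _).le) (ε := ε) n
    have h2 : ∫ ω in A n, f n ω ∂μ ≤ Real.exp (t ^ 2 * V / 2) :=
      (setIntegral_le_integral (hsub.integrable n)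
        (ae_of_all _ fun ω => (Real.exp_pos _).le)).trans (hmean n)
    have h3 : (ε : ENNReal) * μ (A n) ≤ ENNReal.ofReal (Real.exp (t ^ 2 * V / 2)) :=
      h1.trans (ENNReal.ofReal_le_ofReal h2)
    have hε' : (ε : ENNReal) = ENNReal.ofReal (Real.exp c) := by
      rw [← ENNReal.ofReal_coe_nnreal]; rfl
    rw [Real.exp_sub, ENNReal.ofReal_div_of_pos (Real.exp_pos c), ENNReal.le_div_iff_mul_le
      (Or.inl (by simp [Real.exp_pos])) (Or.inl ENNReal.ofReal_ne_top), ← hε', mul_comm]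
    exact h3
  have hmono : Monotone A := by
    intro n m hnm ω hω
    have hω' : (ε : ℝ) ≤ (Finset.range (n + 1)).sup' Finset.nonempty_range_add_one
        fun k => f k ω := hω
    exact hω'.trans (Finset.sup'_mono _ (Finset.range_mono (Nat.succ_le_succ hnm)) _)
  refine (measure_mono ?_).trans
    ((hmono.directed_le.measure_iUnion (μ := μ)).trans_le (iSup_le hA))
  rintro ω ⟨n, hn⟩
  refine Set.mem_iUnion.2 ⟨n, ?_⟩
  exact (Real.exp_le_exp.2 hn).trans
    (Finset.le_sup' (fun k => f k ω) (Finset.self_mem_range_succ n))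

/-- A Gaussian random walk of total variance at most `V` ever leaves `[-δ, δ]` with probability
at most `2 exp (-δ² / (2V))`. -/
lemma measure_exists_lt_abs_sum_le (hm : ∀ n, Measurable (ξ n)) (hi : iIndepFun ξ μ)
    (hξ : ∀ n, μ.map (ξ n) = gaussianReal 0 (s n)) {V : ℝ} (hV0 : 0 < V)
    (hV : ∀ n, ∑ i ∈ Finset.range n, (s i : ℝ) ≤ V) {δ : ℝ} (hδ : 0 < δ) :
    μ {ω | ∃ n, δ < |∑ i ∈ Finset.range n, ξ i ω|} ≤
      ENNReal.ofReal (2 * Real.exp (-(δ ^ 2 / (2 * V)))) := by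
  -- The choice `t = ±δ / V` minimizes the exponent `t ^ 2 * V / 2 - |t| * δ`.
  have hexp : ∀ t : ℝ, t ^ 2 = (δ / V) ^ 2 → t ^ 2 * V / 2 - δ ^ 2 / V = -(δ ^ 2 / (2 * V)) := by
    intro t ht
    rw [ht]
    field_simp
    ring
  have h1 := measure_exists_le_mul_sum_le hm hi hξ hV (δ / V) (δ ^ 2 / V)
  have h2 := measure_exists_le_mul_sum_le hm hi hξ hV (-(δ / V)) (δ ^ 2 / V)
  rw [hexp _ rfl] at h1
  rw [hexp _ (neg_sq _)] at h2
  rw [two_mul, ENNReal.ofReal_add (Real.exp_pos _).le (Real.exp_pos _).le]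
  refine (measure_mono ?_).trans ((measure_union_le _ _).trans (add_le_add h1 h2))
  rintro ω ⟨n, hn⟩
  obtain _ | n := n
  · simp only [Finset.range_zero, Finset.sum_empty, abs_zero] at hn
    exact absurd hn hδ.not_gt
  have hsc : δ ^ 2 / V = δ / V * δ := by ring
  have hpos : 0 ≤ δ / V := by positivity
  rcases lt_abs.1 hn with h | h
  · exact Or.inl ⟨n, hsc ▸ mul_le_mul_of_nonneg_left h.le hpos⟩
  · refine Or.inr ⟨n, ?_⟩
    rw [hsc, neg_mul, ← mul_neg]
    exact mul_le_mul_of_nonneg_left h.le hpos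

/-- A Gaussian random walk of finite total variance converges almost surely. -/
lemma ae_cauchySeq_sum (hm : ∀ n, Measurable (ξ n)) (hi : iIndepFun ξ μ)
    (hξ : ∀ n, μ.map (ξ n) = gaussianReal 0 (s n)) {V : ℝ}
    (hV : ∀ n, ∑ i ∈ Finset.range n, (s i : ℝ) ≤ V) :
    ∀ᵐ ω ∂μ, CauchySeq fun n => ∑ i ∈ Finset.range n, ξ i ω := by
  -- The exponentials of the walk and of its negative are L¹-bounded submartingales. Their limits
  -- multiply to `1`, hence are nonzero, and the logarithm recovers the walk.
  have hconv : ∀ t : ℝ, t ^ 2 = 1 → ∀ᵐ ω ∂μ, ∃ l,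
      Tendsto (fun n => Real.exp (t * ∑ i ∈ Finset.range (n + 1), ξ i ω)) atTop (𝓝 l) := by
    intro t ht
    have hsub := submartingale_exp_sum hm hi hξ t
    have hbdd : ∀ n, eLpNorm (fun ω => Real.exp (t * ∑ i ∈ Finset.range (n + 1), ξ i ω)) 1 μ ≤
        (Real.exp (V / 2)).toNNReal := by
      intro n
      rw [eLpNorm_one_eq_lintegral_enorm]
      simp_rw [Real.enorm_eq_ofReal (Real.exp_pos _).le]
      rw [← ofReal_integral_eq_lintegral_ofReal (hsub.integrable n)
        (ae_of_all _ fun ω => (Real.exp_pos _).le)]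
      refine ENNReal.ofReal_le_ofReal ?_
      have := mgf_sum_of_map_eq_gaussianReal hm hi hξ t (n + 1)
      simp only [mgf, Finset.sum_apply] at this
      rw [this, ht, one_mul, Real.exp_le_exp]
      linarith [hV (n + 1)]
    filter_upwards [hsub.ae_tendsto_limitProcess hbdd] with ω hω using ⟨_, hω⟩
  filter_upwards [hconv 1 (by norm_num), hconv (-1) (by norm_num)] with ω ⟨l, hl⟩ ⟨l', hl'⟩
  have hprod : l * l' = 1 := by
    refine tendsto_nhds_unique (hl.mul hl') ?_
    simp_rw [← Real.exp_add]
    simp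
  have hl0 : l ≠ 0 := left_ne_zero_of_mul_eq_one hprod
  have hlog := hl.log hl0
  simp only [Real.log_exp, one_mul] at hlog
  exact ((tendsto_add_atTop_iff_nat 1).1 hlog).cauchySeq

end GaussianSums

/-! ### Sign and slope of the drift -/

section ArrayFactor

lemma sin_half_mul_sum_sin (M : ℕ) (θ : ℝ) :
    Real.sin (θ / 2) * ∑ m ∈ Finset.range M, Real.sin (m * θ) =
      Real.sin (M * θ / 2) * Real.sin ((M - 1) * θ / 2) := by
  induction M with
  | zero => simp
  | succ M ih =>
    rw [Finset.sum_range_succ, mul_add, ih]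
    push_cast
    have h1 : (M + 1 : ℝ) * θ / 2 = M * θ / 2 + θ / 2 := by ring
    have h2 : (M - 1 : ℝ) * θ / 2 = M * θ / 2 - θ / 2 := by ring
    have h3 : (M : ℝ) * θ = 2 * (M * θ / 2) := by ring
    have h4 : (M + 1 - 1 : ℝ) * θ / 2 = M * θ / 2 := by ring
    rw [h4, h1, h2, h3, Real.sin_two_mul, ← h3, Real.sin_add, Real.sin_sub]
    ring

/-- The angles `θ / 2`, `M * θ / 2` and `(M - 1) * θ / 2` all lie in `(0, π)`, so every sine in the
closed form is positive. -/
lemma sum_sin_pos {M : ℕ} (hM : 2 ≤ M) {θ : ℝ} (h0 : 0 < θ) (h1 : M * θ < 2 * Real.pi) :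
    0 < ∑ m ∈ Finset.range M, Real.sin (m * θ) := by
  have hM' : (2 : ℝ) ≤ M := by exact_mod_cast hM
  have h2 : 2 * θ ≤ M * θ := mul_le_mul_of_nonneg_right hM' h0.le
  have h3 : 0 < Real.sin (θ / 2) := Real.sin_pos_of_pos_of_lt_pi (by linarith) (by linarith)
  refine pos_of_mul_pos_right ?_ h3.le
  rw [sin_half_mul_sum_sin]
  refine mul_pos (Real.sin_pos_of_pos_of_lt_pi (by linarith) (by linarith))
    (Real.sin_pos_of_pos_of_lt_pi ?_ ?_) <;> rw [sub_mul] <;> linarith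

/-- The mean of the imaginary part of the observation when the array with true direction `x` points
in direction `v`. -/
noncomputable def drift (M : ℕ) (d lam x v : ℝ) : ℝ :=
  1 / Real.sqrt M * ∑ m ∈ Finset.range M, Real.sin (m * (2 * Real.pi * d / lam * (v - x)))

/-- As `steeringVector` is conjugated, the phases are multiples of `v - x`, not `x - v`; this gives
the update its restoring sign. -/
lemma observation_im (M : ℕ) (d lam ρ x v : ℝ) (ζ : ℂ) :
    (observation M d lam ρ x (beamformer M d lam v) ζ).im =
      drift M d lam x v + ζ.im / Real.sqrt ρ := by
  have hterm : ∀ a b : ℝ, (Complex.exp (Complex.I * (a : ℂ)) *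
      star (Complex.exp (Complex.I * (b : ℂ)))).im = Real.sin (a - b) := by
    intro a b
    rw [Complex.star_def, ← Complex.exp_conj, ← Complex.exp_add, map_mul, Complex.conj_I,
      Complex.conj_ofReal, ← Complex.exp_ofReal_mul_I_im]
    congr 2
    push_cast
    ring
  rw [observation, Complex.add_im, Complex.div_ofReal_im]
  congr 1
  rw [beamformer, steeringVector, steeringVector, star_smul, star_star, smul_dotProduct,
    Complex.star_def, Complex.conj_ofReal, smul_eq_mul, Complex.im_ofReal_mul, drift, dotProduct,
    Complex.im_sum, ← Fin.sum_univ_eq_sum_range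
      (fun m => Real.sin (m * (2 * Real.pi * d / lam * (v - x))))]
  congr 1
  refine Finset.sum_congr rfl fun m _ => ?_
  rw [Pi.star_apply, hterm]
  congr 1
  ring

lemma continuous_drift (M : ℕ) (d lam x : ℝ) : Continuous (drift M d lam x) := by
  unfold drift
  fun_prop

/-- Oddness transfers every bound to the right of `x` to its left. -/
lemma drift_reflect (M : ℕ) (d lam x u : ℝ) :
    drift M d lam x (2 * x - u) = - drift M d lam x u := by
  rw [drift, drift, ← mul_neg, ← Finset.sum_neg_distrib]
  congr 1
  refine Finset.sum_congr rfl fun m _ => ?_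
  rw [← Real.sin_neg]
  congr 1
  ring

lemma drift_self (M : ℕ) (d lam x : ℝ) : drift M d lam x x = 0 := by
  simp [drift]

variable {M : ℕ} {d lam x u : ℝ}

lemma drift_pos (hM : 2 ≤ M) (hd : 0 < d) (hlam : 0 < lam) (h0 : x < u)
    (h1 : u < x + lam / (M * d)) : 0 < drift M d lam x u := by
  have hM' : (0 : ℝ) < M := by exact_mod_cast (by lia : 0 < M)
  refine mul_pos (by positivity) (sum_sin_pos hM (mul_pos (by positivity) (sub_pos.2 h0)) ?_)
  have h2 : u - x < lam / (M * d) := by linarith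
  rw [lt_div_iff₀ (by positivity)] at h2
  have h3 : (M : ℝ) * (2 * Real.pi * d / lam * (u - x)) =
      2 * Real.pi * (((u - x) * (M * d)) / lam) := by ring
  rw [h3]
  exact mul_lt_of_lt_one_right (by positivity) ((div_lt_one hlam).2 h2)

lemma drift_neg (hM : 2 ≤ M) (hd : 0 < d) (hlam : 0 < lam) (h0 : u < x)
    (h1 : x - lam / (M * d) < u) : drift M d lam x u < 0 := by
  have := drift_pos hM hd hlam (x := x) (u := 2 * x - u) (by linarith) (by linarith)
  rw [drift_reflect] at this
  linarith

/-- A Lipschitz constant of the drift. -/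
noncomputable def driftSlope (M : ℕ) (d lam : ℝ) : ℝ :=
  1 / Real.sqrt M * ∑ m ∈ Finset.range M, (m : ℝ) * (2 * Real.pi * d / lam)

lemma drift_le (hd : 0 < d) (hlam : 0 < lam) (h : x ≤ u) :
    drift M d lam x u ≤ driftSlope M d lam * (u - x) := by
  rw [drift, driftSlope, mul_assoc (1 / Real.sqrt M), Finset.sum_mul]
  refine mul_le_mul_of_nonneg_left (Finset.sum_le_sum fun m _ => ?_) (by positivity)
  rw [mul_assoc (m : ℝ)]
  have := sub_nonneg.2 h
  exact Real.sin_le (by positivity)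

end ArrayFactor

/-! ### Sums of step sizes and of their squares -/

section Steps

variable {α : ℝ} {N₀ : ℕ}

lemma stepSize_nonneg (hα : 0 < α) (n : ℕ) : 0 ≤ stepSize α N₀ n := by
  unfold stepSize
  positivity

lemma tendsto_sum_stepSize (hα : 0 < α) :
    Tendsto (fun n => ∑ i ∈ Finset.range n, stepSize α N₀ (i + 1)) atTop atTop := by
  refine (not_summable_iff_tendsto_nat_atTop_of_nonneg fun n => stepSize_nonneg hα _).1 ?_
  intro h
  have h1 : Summable fun n : ℕ => (1 : ℝ) / ((n + (1 + N₀) : ℕ) : ℝ) := by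
    refine (h.mul_left α⁻¹).congr fun n => ?_
    rw [stepSize, ← mul_div_assoc, inv_mul_cancel₀ hα.ne']
    push_cast
    ring
  exact Real.not_summable_one_div_natCast
    ((summable_nat_add_iff (f := fun n : ℕ => (1 : ℝ) / (n : ℝ)) (1 + N₀)).1 h1)

/-- Telescoping with `1 / (k + 1) ^ 2 ≤ 1 / k - 1 / (k + 1)`. The bound does not involve `N₀`, so
the final constant does not either. -/
lemma sum_stepSize_sq_le (hN : 1 ≤ N₀) (n : ℕ) :
    ∑ i ∈ Finset.range n, stepSize α N₀ (i + 1) ^ 2 ≤ α ^ 2 := by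
  have hN' : (1 : ℝ) ≤ N₀ := by exact_mod_cast hN
  have key : ∑ i ∈ Finset.range n, stepSize α N₀ (i + 1) ^ 2 ≤
      α ^ 2 * (1 / N₀ - 1 / (n + N₀)) := by
    induction n with
    | zero => simp
    | succ n ih =>
      rw [Finset.sum_range_succ]
      have hstep : stepSize α N₀ (n + 1) ^ 2 ≤
          α ^ 2 * (1 / (n + N₀) - 1 / ((n + 1 : ℕ) + N₀)) := by
        rw [stepSize, div_pow, div_eq_mul_inv]
        refine mul_le_mul_of_nonneg_left ?_ (sq_nonneg α)
        push_cast
        rw [div_sub_div _ _ (by positivity) (by positivity), inv_eq_one_div,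
          div_le_div_iff₀ (by positivity) (by positivity)]
        nlinarith [(Nat.cast_nonneg n : (0 : ℝ) ≤ n)]
      linarith
  refine key.trans (mul_le_of_le_one_right (sq_nonneg α) ?_)
  have h1 : (1 : ℝ) / N₀ ≤ 1 := (div_le_one (by linarith)).2 hN'
  have h2 : (0 : ℝ) ≤ 1 / (n + N₀) := by positivity
  linarith

end Steps

/-! ### Law of the imaginary noise -/

section Noise

variable {Ω : Type*} {mΩ : MeasurableSpace Ω} {μ : Measure Ω}

lemma map_im_stdComplexGaussian :
    stdComplexGaussian.map Complex.im = gaussianReal 0 (1 / 2) := by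
  have hm : Measurable fun p : ℝ × ℝ => (⟨p.1, p.2⟩ : ℂ) :=
    Complex.measurableEquivRealProd.symm.measurable
  rw [stdComplexGaussian, Measure.map_map Complex.measurable_im hm]
  change Measure.map Prod.snd _ = _
  rw [Measure.map_snd_prod]
  simp

lemma map_const_mul_im_of_map_eq {Z : Ω → ℂ} (hm : Measurable Z)
    (h : μ.map Z = stdComplexGaussian) (c : ℝ) :
    μ.map (fun ω => c * (Z ω).im) = gaussianReal 0 (NNReal.mk (c ^ 2) (sq_nonneg c) * (1 / 2)) := by
  have h1 : (fun ω => c * (Z ω).im) = (fun y => c * y) ∘ Complex.im ∘ Z := rfl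
  rw [h1, ← Measure.map_map (by fun_prop) (by fun_prop),
    ← Measure.map_map Complex.measurable_im hm, h, map_im_stdComplexGaussian,
    gaussianReal_map_const_mul, mul_zero]

end Noise

/-! ### Convergence probability and conditioning on the start -/

section Convergence

variable {Ω : Type*} {mΩ : MeasurableSpace Ω} {μ : Measure Ω} [IsProbabilityMeasure μ]

/-- The tracker started at a deterministic point of the mainlobe converges to the true direction
as soon as the accumulated noise converges and stays below a third of the distance of the starting
point to the edge of the mainlobe. -/
lemma tendsto_estimate {M : ℕ} {d lam ρ x α v : ℝ} {N₀ : ℕ} {ζ : ℕ → ℂ} (hM : 2 ≤ M) (hd : 0 < d)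
    (hlam : 0 < lam) (hx : x ∈ Set.Icc (-1 : ℝ) 1) (hα : 0 < α) (hN : 1 ≤ N₀)
    (hN' : α * driftSlope M d lam ≤ N₀) (hv : v ∈ mainlobe M d lam x)
    (hbound : ∀ n, |∑ i ∈ Finset.range n, stepSize α N₀ (i + 1) / Real.sqrt ρ * (ζ i).im| ≤
      (lam / (M * d) - |v - x|) / 3)
    (hS : CauchySeq fun n =>
      ∑ i ∈ Finset.range n, stepSize α N₀ (i + 1) / Real.sqrt ρ * (ζ i).im) :
    Tendsto (estimate M d lam ρ x α N₀ v ζ) atTop (𝓝 x) := by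
  set S : ℕ → ℝ := fun n =>
    ∑ i ∈ Finset.range n, stepSize α N₀ (i + 1) / Real.sqrt ρ * (ζ i).im with hSdef
  set R := lam / (M * d) with hR
  set e := estimate M d lam ρ x α N₀ v ζ with he
  have hlt : |v - x| < R := abs_lt.2 ⟨by linarith [hv.1.1], by linarith [hv.1.2]⟩
  have hrec : ∀ n, e (n + 1) = max (min (e n - stepSize α N₀ (n + 1) * drift M d lam x (e n) -
      (S (n + 1) - S n)) 1) (-1) := by
    intro n
    simp only [he, hSdef, estimate, observation_im, Finset.sum_range_succ]
    congr 2
    ring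
  have hL : ∀ n, stepSize α N₀ (n + 1) * driftSlope M d lam ≤ 1 := by
    intro n
    have h0 : (0 : ℝ) < N₀ := by exact_mod_cast hN
    rw [stepSize, div_mul_eq_mul_div, div_le_one (by positivity)]
    refine hN'.trans ?_
    push_cast
    linarith [(Nat.cast_nonneg n : (0 : ℝ) ≤ n)]
  have ha0 : ∀ n, 0 ≤ stepSize α N₀ (n + 1) := fun n => stepSize_nonneg hα _
  have hup : ∀ n u, x ≤ u → u < x + R → 0 ≤ stepSize α N₀ (n + 1) * drift M d lam x u ∧
      stepSize α N₀ (n + 1) * drift M d lam x u ≤ u - x := by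
    intro n u h1 h2
    constructor
    · rcases h1.eq_or_lt with rfl | h1
      · rw [drift_self, mul_zero]
      · exact mul_nonneg (ha0 n) (drift_pos hM hd hlam h1 h2).le
    · have h3 := mul_le_mul_of_nonneg_left (drift_le (M := M) hd hlam h1) (ha0 n)
      have h4 := mul_le_mul_of_nonneg_right (hL n) (sub_nonneg.2 h1)
      linarith
  have hdown : ∀ n u, u ≤ x → x - R < u → stepSize α N₀ (n + 1) * drift M d lam x u ≤ 0 ∧
      u - x ≤ stepSize α N₀ (n + 1) * drift M d lam x u := by
    intro n u h1 h2
    have h3 := hup n (2 * x - u) (by linarith) (by linarith)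
    rw [drift_reflect] at h3
    constructor <;> linarith
  -- Any fraction of the gap below one half would satisfy both cases; a third is used.
  have hmax : max |v - x| ((R - |v - x|) / 3) + (R - |v - x|) / 3 < R := by
    rcases max_cases |v - x| ((R - |v - x|) / 3) with ⟨h, _⟩ | ⟨h, _⟩ <;> rw [h]
    · linarith
    · linarith [abs_nonneg (v - x)]
  refine tendsto_clamped hx hrec hup hdown (continuous_drift M d lam x)
    (fun u => drift_pos hM hd hlam) (fun u => drift_neg hM hd hlam) ha0 (tendsto_sum_stepSize hα)
    hS hmax fun n => ?_
  refine abs_clamped_sub_le hx hrec hup hdown (N := 0) (fun n _ => ?_) le_rfl hmax (Nat.zero_le n)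
  simpa [hSdef] using hbound n

/-- A lower bound on the probability that the tracker started at a deterministic point of the
mainlobe converges to the true direction. -/
lemma le_measureReal_tendsto_estimate {M : ℕ} {d lam ρ x α v : ℝ} {N₀ : ℕ} {z : ℕ → Ω → ℂ}
    (hM : 2 ≤ M) (hd : 0 < d) (hlam : 0 < lam) (hx : x ∈ Set.Icc (-1 : ℝ) 1) (hα : 0 < α)
    (hN : 1 ≤ N₀) (hN' : α * driftSlope M d lam ≤ N₀) (hρ : 0 < ρ)
    (hv : v ∈ mainlobe M d lam x) (hz : ∀ n, Measurable (z n))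
    (hlaw : ∀ n, μ.map (z n) = stdComplexGaussian) (hi : iIndepFun z μ) :
    1 - 2 * Real.exp (-((lam / (M * d) - |v - x|) / 3) ^ 2 * (ρ / α ^ 2)) ≤
      μ.real {ω | Tendsto (estimate M d lam ρ x α N₀ v fun n => z n ω) atTop (𝓝 x)} := by
  set δ := (lam / (M * d) - |v - x|) / 3 with hδ
  have hlt : |v - x| < lam / (M * d) := abs_lt.2 ⟨by linarith [hv.1.1], by linarith [hv.1.2]⟩
  have hδ0 : 0 < δ := by linarith
  set c : ℕ → ℝ := fun n => stepSize α N₀ (n + 1) / Real.sqrt ρ with hc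
  have hm : ∀ n, Measurable fun ω => c n * (z n ω).im := fun n =>
    (Complex.measurable_im.comp (hz n)).const_mul _
  have hξ := fun n => map_const_mul_im_of_map_eq (hz n) (hlaw n) (c n)
  have hi' : iIndepFun (fun n ω => c n * (z n ω).im) μ :=
    hi.comp (fun n (w : ℂ) => c n * w.im) fun n => Complex.measurable_im.const_mul _
  have hV : ∀ n, ∑ i ∈ Finset.range n,
      ((NNReal.mk (c i ^ 2) (sq_nonneg (c i)) * (1 / 2) : NNReal) : ℝ) ≤ α ^ 2 / (2 * ρ) := by
    intro n
    have h1 : ∀ i ∈ Finset.range n,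
        ((NNReal.mk (c i ^ 2) (sq_nonneg (c i)) * (1 / 2) : NNReal) : ℝ) =
          stepSize α N₀ (i + 1) ^ 2 * (1 / (2 * ρ)) := by
      intro i _
      change c i ^ 2 * (1 / 2) = _
      rw [hc, div_pow, Real.sq_sqrt hρ.le]
      field_simp
    rw [Finset.sum_congr rfl h1, ← Finset.sum_mul, div_eq_mul_one_div (α ^ 2)]
    exact mul_le_mul_of_nonneg_right (sum_stepSize_sq_le hN n) (by positivity)
  have hmain := measure_exists_lt_abs_sum_le hm hi' hξ (by positivity) hV hδ0
  have hcau := ae_cauchySeq_sum hm hi' hξ hV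
  set A := {ω | Tendsto (estimate M d lam ρ x α N₀ v fun n => z n ω) atTop (𝓝 x)} with hA
  have hsub : (Aᶜ : Set Ω) ≤ᵐ[μ] {ω | ∃ n, δ < |∑ i ∈ Finset.range n, c i * (z i ω).im|} := by
    filter_upwards [hcau] with ω hω hωA
    by_contra hcon
    have hcon' : ∀ n, |∑ i ∈ Finset.range n, c i * (z i ω).im| ≤ δ := by
      intro n
      by_contra! h
      exact hcon ⟨n, h⟩
    exact hωA (tendsto_estimate hM hd hlam hx hα hN hN' hv hcon' hω)
  have hAc : μ.real Aᶜ ≤ 2 * Real.exp (-(δ ^ 2 / (2 * (α ^ 2 / (2 * ρ))))) :=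
    ENNReal.toReal_le_of_le_ofReal (by positivity) ((measure_mono_ae hsub).trans hmain)
  have hone : 1 ≤ μ.real A + μ.real Aᶜ := by
    have := measureReal_union_le (μ := μ) A Aᶜ
    rwa [Set.union_compl_self, probReal_univ] at this
  have hexp : -(δ ^ 2 / (2 * (α ^ 2 / (2 * ρ)))) = -δ ^ 2 * (ρ / α ^ 2) := by
    field_simp
  rw [hexp] at hAc
  linarith

/-- Joint measurability makes convergence a measurable event in the pair (start, noise), as freezing
the start requires. -/
lemma measurable_estimate (M : ℕ) (d lam ρ x α : ℝ) (N₀ n : ℕ) :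
    Measurable fun p : ℝ × (ℕ → ℂ) => estimate M d lam ρ x α N₀ p.1 p.2 n := by
  induction n with
  | zero => exact measurable_fst
  | succ n ih =>
    simp only [estimate, observation_im]
    have h1 := (continuous_drift M d lam x).measurable.comp ih
    have h2 : Measurable fun p : ℝ × (ℕ → ℂ) => (p.2 n).im :=
      Complex.measurable_im.comp ((measurable_pi_apply n).comp measurable_snd)
    exact ((ih.sub ((h1.add (h2.div_const _)).const_mul _)).min measurable_const).max
      measurable_const

/-- The conditional probability given `X` of an event determined by `X` and an independent
variable `Y` is obtained by freezing `X`. -/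
lemma condExp_indicator_ae_eq_of_indepFun {E F : Type*} [MeasurableSpace E] [MeasurableSpace F]
    [StandardBorelSpace F] [Nonempty F] {X : Ω → E} {Y : Ω → F} (hX : Measurable X)
    (hY : Measurable Y) (h : IndepFun X Y μ) {A : Set (E × F)} (hA : MeasurableSet A) :
    μ⟦{ω | (X ω, Y ω) ∈ A} | MeasurableSpace.comap X inferInstance⟧ =ᵐ[μ]
      fun ω => μ.real {ω' | (X ω, Y ω') ∈ A} := by
  -- The joint law is a product, so the conditional law of `Y` is a constant kernel.
  have hκ : condDistrib Y X μ =ᵐ[μ.map X] Kernel.const E (μ.map Y) := by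
    have : IsProbabilityMeasure (μ.map Y) := Measure.isProbabilityMeasure_map hY.aemeasurable
    refine condDistrib_ae_eq_of_measure_eq_compProd X hY.aemeasurable ?_
    rw [Measure.compProd_const]
    exact (indepFun_iff_map_prod_eq_prod_map_map hX.aemeasurable hY.aemeasurable).1 h
  have hcond := condExp_prod_ae_eq_integral_condDistrib (μ := μ) hX hY.aemeasurable
    (f := A.indicator fun _ => (1 : ℝ)) (stronglyMeasurable_const.indicator hA)
    ((integrable_const (1 : ℝ)).indicator (hX.prodMk hY hA))
  filter_upwards [hcond, ae_of_ae_map hX.aemeasurable hκ] with ω h1 h2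
  have hAω : MeasurableSet (Prod.mk (X ω) ⁻¹' A) := measurable_prodMk_left hA
  refine h1.trans ?_
  rw [h2, Kernel.const_apply]
  change ∫ y, (Prod.mk (X ω) ⁻¹' A).indicator (fun _ => (1 : ℝ)) y ∂μ.map Y = _
  rw [integral_indicator_const _ hAω, smul_eq_mul, mul_one, map_measureReal_apply hY hAω]
  rfl

end Convergence

end BeamTracking

theorem theorem2 (M : ℕ) (hM : 2 ≤ M) (d lam : ℝ) (hd : 0 < d) (hlam : 0 < lam)
    (x : ℝ) (hx : x ∈ Set.Icc (-1 : ℝ) 1) :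
    ∃ C : ℝ → ℝ, (∀ v ∈ BeamTracking.mainlobe M d lam x, 0 < C v) ∧
      ∀ α : ℝ, 0 < α → ∃ N₀ : ℕ, ∀ ρ : ℝ, 0 < ρ →
        ∀ (Ω : Type*) [MeasurableSpace Ω] (μ : Measure Ω) [IsProbabilityMeasure μ]
          (x₀ : Ω → ℝ) (z : ℕ → Ω → ℂ),
          Measurable x₀ → (∀ n, Measurable (z n)) →
          (∀ n, μ.map (z n) = BeamTracking.stdComplexGaussian) →
          iIndepFun z μ →
          IndepFun x₀ (fun ω n => z n ω) μ →
          ∀ᵐ ω ∂μ, x₀ ω ∈ BeamTracking.mainlobe M d lam x →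
            1 - 2 * Real.exp (-C (x₀ ω) * (ρ / α ^ 2)) ≤
              (μ⟦{ω' | Tendsto (BeamTracking.estimate M d lam ρ x α N₀ (x₀ ω') (fun n => z n ω'))
                  atTop (𝓝 x)} | MeasurableSpace.comap x₀ inferInstance⟧) ω := by
  refine ⟨fun v => ((lam / (M * d) - |v - x|) / 3) ^ 2, fun v hv => ?_, fun α hα => ?_⟩
  · have : |v - x| < lam / (M * d) := abs_lt.2 ⟨by linarith [hv.1.1], by linarith [hv.1.2]⟩
    have : 0 < lam / (M * d) - |v - x| := by linarith
    positivity
  obtain ⟨N, hN⟩ := exists_nat_ge (α * BeamTracking.driftSlope M d lam)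
  -- `N` rules out overshoot; the extra `1` gives `1 ≤ N₀` for the bound on the squared steps.
  refine ⟨N + 1, fun ρ hρ Ω _ μ _ x₀ z hx₀ hz hlaw hi hindep => ?_⟩
  have hA : MeasurableSet {p : ℝ × (ℕ → ℂ) |
      Tendsto (BeamTracking.estimate M d lam ρ x α (N + 1) p.1 p.2) atTop (𝓝 x)} :=
    measurableSet_tendsto (𝓝 x) fun n => BeamTracking.measurable_estimate M d lam ρ x α (N + 1) n
  filter_upwards [BeamTracking.condExp_indicator_ae_eq_of_indepFun hx₀ (measurable_pi_lambda _ hz)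
    hindep hA] with ω hω hmem
  refine le_of_le_of_eq ?_ hω.symm
  exact BeamTracking.le_measureReal_tendsto_estimate hM hd hlam hx hα (by lia)
    (hN.trans (by exact_mod_cast Nat.le_succ N)) hρ hmem hz hlaw hi
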